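/- **Setting.** Let $C$ be a convex subset of a real vector space, symmetric with respect to a point $x_0\in C$ (that is, $C-x_0=-(C-x_0)$). Let $\mu$ be the Minkowski functional of $C-x_0$, let $X_0:=\operatorname{span}(C-x_0)$ with algebraic dual $X_0'$, and let $B_\mu(x_0,1):=\{x\in x_0+X_0:\mu(x-x_0)<1\}$ (which is contained in $C$). A function $f:C\to\mathbb R$ is *$\mu$-Lipschitz* if there is $L>0$ with $|f(u)-f(v)|\le L\,\mu(u-v)$ for all $u,v\in C$. For such $f$, $x\in B_\mu(x_0,1)$ and $v\in X_0$ put $$f^\circ(x,v):=\limsup_{\mu(y-x)\to0,\ t\to0+}\frac{f(y+tv)-f(y)}{t},\qquad \partial_C^\mu f(x):=\{\zeta\in X_0':\ f^\circ(x,v)\ge\langle\zeta,v\rangle\ \text{for all } v\in X_0\}$$ (where $y$ ranges over $x+X_0$), and call $f$ *regular* at $x$ if for every $v\in X_0$ the directional derivative $f'(x,v)=\lim_{t\to0+}(f(x+tv)-f(x))/t$ exists and equals $f^\circ(x,v)$. For a Lipschitz function $g:\mathbb R^n\to\mathbb R$, let $\partial_C g(u)\subset\mathbb R^n$ be the usual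 Clarke subdifferential, and let regularity be understood in the usual sense of Clarke. **Theorem 3.2 (Chain rule II, with Corollary 3.2.1).** Let $h=(h_1,\dots,h_n):C\to\mathbb R^n$ have $\mu$-Lipschitz components, let $g:\mathbb R^n\to\mathbb R$ be Lipschitz, and put $\varphi:=g\circ h$. Let $X_0$ be supplied with a vector topology for which $\mu$ is continuous, and let $X_0^*\subset X_0'$ be its topological dual. Then for every $x\in B_\mu(x_0,1)$ the set $$A(x):=\Big\{\sum_{i=1}^n\alpha_i\zeta_i:\ \zeta_i\in\partial_C^\mu h_i(x),\ \alpha\in\partial_C g(h(x))\Big\}$$ is contained in $X_0^*$, and $$\partial_C^\mu\varphi(x)\subset\overline{\operatorname{co}}\,A(x),$$ where $\overline{\operatorname{co}}$ denotes the closed convex hull in $X_0^*$ with respect to the topology $\sigma(X_0^*,X_0)$. Moreover, equality $\partial_C^\mu\varphi(x)=\overline{\operatorname{co}}\,A(x)$ holds at a point $x\in B_\mu(x_0,1)$ if in addition 1. $g$ is regular at $h(x)$ and every $h_i$ is regular at $x$; 2. every $\alpha\in\partial_C g(h(x))$ has non-negative components; 3. the topology of $X_0$ is a complete Hausdorff locally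 convex topology (with $\mu$ continuous). -/

import Mathlib

open Filter Topology

noncomputable section

namespace MuClarke

/-! ### Sets symmetric about a point, and their Minkowski functionals -/

section Gauge

variable {E : Type*} [AddCommGroup E] [Module ℝ E]

/-- The translate `C - x₀` of the set `C`. -/
def shift (C : Set E) (x₀ : E) : Set E := {v | x₀ + v ∈ C}

/-- `C` is symmetric with respect to the point `x₀`, i.e. `C - x₀ = -(C - x₀)`. -/
def SymmetricAbout (C : Set E) (x₀ : E) : Prop := ∀ v : E, x₀ + v ∈ C → x₀ - v ∈ C

/-- The space `X₀ = span (C - x₀)`. -/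
abbrev dirSpace (C : Set E) (x₀ : E) : Submodule ℝ E := Submodule.span ℝ (shift C x₀)

/-- `μ`, the Minkowski functional of `C - x₀`. Only its values on `dirSpace C x₀` are meaningful
(outside of that subspace `gauge` is the infimum of the empty set). -/
def mu (C : Set E) (x₀ : E) (v : E) : ℝ := gauge (shift C x₀) v

/-- The open ball `B_μ(x₀, 1)`; it consists of points of `x₀ + X₀`. -/
def muBall (C : Set E) (x₀ : E) : Set E :=
  {x | x - x₀ ∈ dirSpace C x₀ ∧ mu C x₀ (x - x₀) < 1}

/-- `f` is `μ`-Lipschitz on `C`. -/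
def MuLipschitz (C : Set E) (x₀ : E) (f : E → ℝ) : Prop :=
  ∃ L : ℝ, 0 < L ∧ ∀ u ∈ C, ∀ v ∈ C, |f u - f v| ≤ L * mu C x₀ (u - v)

/-- The filter of `μ`-neighbourhoods of `x` in `x + X₀`; convergence of `y` along it means
that `y - x ∈ X₀` and `μ (y - x) → 0`. -/
def muNhds (C : Set E) (x₀ x : E) : Filter E :=
  map (fun u : dirSpace C x₀ => x + (u : E))
    (comap (fun u : dirSpace C x₀ => mu C x₀ (u : E)) (𝓝 0))

end Gauge

/-! ### Generalized directional derivatives, subdifferentials, regularity -/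

section Clarke

variable {E : Type*} [AddCommGroup E] [Module ℝ E]

/-- The upper limit of `(f (y + t v) - f y) / t` as `t → 0+` and `y` tends to the base point
along the filter `l`. -/
def upperDeriv (l : Filter E) (f : E → ℝ) (v : E) : ℝ :=
  limsup (fun p : E × ℝ => (f (p.1 + p.2 • v) - f p.1) / p.2) (l ×ˢ 𝓝[>] (0 : ℝ))

/-- The one-sided directional derivative of `f` at `x` in the direction `v` exists and
equals `d`. -/
def HasDirDeriv (f : E → ℝ) (x v : E) (d : ℝ) : Prop :=
  Tendsto (fun t : ℝ => (f (x + t • v) - f x) / t) (𝓝[>] (0 : ℝ)) (𝓝 d)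

/-- The generalized directional derivative `f°(x, v)` with respect to `μ`
(upper limit over `μ (y - x) → 0`, `t → 0+`). For `x ∈ B_μ(x₀, 1)` and `v ∈ X₀` it depends only
on the values of `f` on `C`. -/
def muDeriv (C : Set E) (x₀ : E) (f : E → ℝ) (x v : E) : ℝ :=
  upperDeriv (muNhds C x₀ x) f v

/-- The Clarke subdifferential `∂_C^μ f(x)`, a subset of the algebraic dual of `X₀`. -/
def muSubdiff (C : Set E) (x₀ : E) (f : E → ℝ) (x : E) : Set (Module.Dual ℝ (dirSpace C x₀)) :=
  {ζ | ∀ v : dirSpace C x₀, ζ v ≤ muDeriv C x₀ f x (v : E)}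

/-- `f` is regular at `x` with respect to `μ`: for every `v ∈ X₀` the directional derivative
`f'(x, v)` exists and equals `f°(x, v)`. -/
def MuRegularAt (C : Set E) (x₀ : E) (f : E → ℝ) (x : E) : Prop :=
  ∀ v : dirSpace C x₀, ∃ d : ℝ, HasDirDeriv f x (v : E) d ∧ d = muDeriv C x₀ f x (v : E)

end Clarke

/-! ### The classical notions on `ℝⁿ` -/

section Euclidean

variable {n : ℕ}

/-- Clarke's generalized directional derivative `g°(u, w)` on `ℝⁿ`. -/
def clarkeDeriv (g : EuclideanSpace ℝ (Fin n) → ℝ) (u w : EuclideanSpace ℝ (Fin n)) : ℝ :=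
  upperDeriv (𝓝 u) g w

/-- Clarke's subdifferential `∂_C g(u)`, where `α ∈ ℝⁿ` stands for the functional
`w ↦ ∑ i, α i * w i`. -/
def clarkeSubdiff (g : EuclideanSpace ℝ (Fin n) → ℝ) (u : EuclideanSpace ℝ (Fin n)) :
    Set (EuclideanSpace ℝ (Fin n)) :=
  {α | ∀ w : EuclideanSpace ℝ (Fin n), ∑ i, α i * w i ≤ clarkeDeriv g u w}

/-- `g` is regular at `u` in the sense of Clarke. -/
def ClarkeRegularAt (g : EuclideanSpace ℝ (Fin n) → ℝ) (u : EuclideanSpace ℝ (Fin n)) : Prop :=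
  ∀ w : EuclideanSpace ℝ (Fin n), ∃ d : ℝ, HasDirDeriv g u w d ∧ d = clarkeDeriv g u w

end Euclidean

/-! ### The right-hand side of the chain rule -/

section ChainRule

variable {E : Type*} [AddCommGroup E] [Module ℝ E] {n : ℕ}

/-- The set of all `∑ i, α i • ζ i` with `ζ i ∈ ∂_C^μ h_i(x)` and `α ∈ ∂_C g(h(x))`. -/
def chainSet (C : Set E) (x₀ : E) (g : EuclideanSpace ℝ (Fin n) → ℝ)
    (h : E → EuclideanSpace ℝ (Fin n)) (x : E) : Set (Module.Dual ℝ (dirSpace C x₀)) :=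
  {ξ | ∃ ζ : Fin n → Module.Dual ℝ (dirSpace C x₀), ∃ α ∈ clarkeSubdiff g (h x),
    (∀ i, ζ i ∈ muSubdiff C x₀ (fun y => h y i) x) ∧ ξ = ∑ i, α i • ζ i}

end ChainRule

section Dual

variable (V : Type*) [AddCommGroup V] [Module ℝ V] [TopologicalSpace V]

/-- The inclusion of the continuous dual `V*`, carrying the topology `σ(V*, V)`, into the
algebraic dual `V'`. -/
def dualIncl (ξ : WeakDual ℝ V) : Module.Dual ℝ V := (WeakDual.toStrongDual ξ).toLinearMap

variable {V}

/-- The closed convex hull, in `V*` with the topology `σ(V*, V)`, of a set `A` of linear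
functionals (meant for `A ⊆ V*`), viewed again as a set of linear functionals. -/
def weakStarHull (A : Set (Module.Dual ℝ V)) : Set (Module.Dual ℝ V) :=
  dualIncl V '' closure (convexHull ℝ (dualIncl V ⁻¹' A))

end Dual

end MuClarke

end

/-! Everything is transported to `X₀` with the seminorm `μ`, by passing from `f` to `u ↦ f (x + u)`;
Clarke derivatives on `ℝⁿ` are the same construction for the norm.

For the inclusion, fix `v` and choose an ultrafilter along which the difference quotients of `φ`
tend to `φ°(v)`. By boundedness the quotients of each `h i` converge along it too, to some `w i`
between `-h_i°(-v)` and `h_i°(v)`. Since `h_i°` is sublinear, Hahn-Banach gives `ζ i ∈ ∂h_i` with `ζ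
i v = w i`. As `g` is Lipschitz, the increment of `h` may be replaced by `t • w`, so `φ°(v) ≤ g°(h
x; w) = ∑ α i * w i` for some `α ∈ ∂g` (`exists_chain_ge`). Thus each `φ°(v)` is dominated by an
element of `A(x)`, and weak-star separation puts every subgradient of `φ` in the closed convex hull
(`mem_weakStarHull`).

For equality, non-negativity of `α` and regularity give `∑ α i * ζ i v ≤ ∑ α i * h_i'(v) ≤ g'(h x;
h'(v)) = φ'(x, v) ≤ φ°(v)` (`chain_le`). The bound by `φ°` survives weak-star closed convex hulls.
-/

open Filter Topology

namespace MuClarke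

/-! ### Upper directional derivatives with respect to a seminorm -/

section Seminorm

variable {V : Type*} [AddCommGroup V] [Module ℝ V]

/-- `F` is Lipschitz with constant `L` with respect to the seminorm `p` on some `p`-ball
about the origin. -/
def LipschitzNearZero (p : Seminorm ℝ V) (L : ℝ) (F : V → ℝ) : Prop :=
  ∃ r > 0, ∀ u v, p u < r → p v < r → |F u - F v| ≤ L * p (u - v)

/-- The filter along which difference quotients at the origin are taken. -/
def quotFilter (p : Seminorm ℝ V) : Filter (V × ℝ) := comap p (𝓝 0) ×ˢ 𝓝[>] (0 : ℝ)

/-- The difference quotient of `F` in the direction `v`. -/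
noncomputable def diffQuot (F : V → ℝ) (v : V) (q : V × ℝ) : ℝ := (F (q.1 + q.2 • v) - F q.1) / q.2

/-- The upper directional derivative of `F` at the origin with respect to `p`. -/
noncomputable def seminormDeriv (p : Seminorm ℝ V) (F : V → ℝ) (v : V) : ℝ :=
  upperDeriv (comap p (𝓝 0)) F v

theorem pure_zero_le_comap (p : Seminorm ℝ V) : pure 0 ≤ comap p (𝓝 0) := by
  rw [← map_le_iff_le_comap, map_pure, map_zero]
  exact pure_le_nhds 0

theorem pure_zero_prod_le (p : Seminorm ℝ V) :
    pure (0 : V) ×ˢ 𝓝[>] (0 : ℝ) ≤ quotFilter p :=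
  Filter.prod_mono (pure_zero_le_comap p) le_rfl

instance (p : Seminorm ℝ V) : (quotFilter p).NeBot :=
  NeBot.mono inferInstance (pure_zero_prod_le p)

variable {p : Seminorm ℝ V} {F : V → ℝ} {L : ℝ}

theorem tendsto_seminorm_fst (p : Seminorm ℝ V) :
    Tendsto (fun q : V × ℝ => p q.1) (quotFilter p) (𝓝 0) :=
  tendsto_comap.comp tendsto_fst

theorem tendsto_snd_quotFilter (p : Seminorm ℝ V) :
    Tendsto (fun q : V × ℝ => q.2) (quotFilter p) (𝓝[>] 0) := tendsto_snd

theorem eventually_snd_pos (p : Seminorm ℝ V) : ∀ᶠ q in quotFilter p, 0 < q.2 :=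
  (tendsto_snd_quotFilter p).eventually self_mem_nhdsWithin

/-- Moving the base point along the direction does not leave the filter. -/
theorem tendsto_shear (p : Seminorm ℝ V) (v : V) :
    Tendsto (fun q : V × ℝ => (q.1 + q.2 • v, q.2)) (quotFilter p) (quotFilter p) := by
  refine Tendsto.prodMk (tendsto_comap_iff.2 ?_) (tendsto_snd_quotFilter p)
  have h1 : Tendsto (fun q : V × ℝ => p q.1 + |q.2| * p v) (quotFilter p) (𝓝 0) := by
    have h2 : Tendsto (fun q : V × ℝ => |q.2|) (quotFilter p) (𝓝 0) := by
      simpa using ((tendsto_snd_quotFilter p).mono_right nhdsWithin_le_nhds).abs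
    simpa using (tendsto_seminorm_fst p).add (h2.mul_const (p v))
  refine squeeze_zero (fun _ => apply_nonneg p _) (fun q => ?_) h1
  refine (map_add_le_add p _ _).trans_eq ?_
  rw [map_smul_eq_mul, Real.norm_eq_abs]

/-- Rescaling the step by a positive factor does not leave the filter. -/
theorem tendsto_rescale (p : Seminorm ℝ V) {c : ℝ} (hc : 0 < c) :
    Tendsto (fun q : V × ℝ => (q.1, c * q.2)) (quotFilter p) (quotFilter p) := by
  refine Tendsto.prodMk tendsto_fst (tendsto_nhdsWithin_iff.2 ⟨?_, ?_⟩)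
  · simpa using ((tendsto_snd_quotFilter p).mono_right nhdsWithin_le_nhds).const_mul c
  · filter_upwards [eventually_snd_pos p] with q hq using mul_pos hc hq

theorem LipschitzNearZero.eventually_abs_diffQuot_le (hF : LipschitzNearZero p L F) (v : V) :
    ∀ᶠ q in quotFilter p, |diffQuot F v q| ≤ L * p v := by
  obtain ⟨r, hr, h⟩ := hF
  have h1 := (tendsto_seminorm_fst p).eventually (gt_mem_nhds hr)
  have h2 := ((tendsto_seminorm_fst p).comp (tendsto_shear p v)).eventually (gt_mem_nhds hr)
  filter_upwards [h1, h2, eventually_snd_pos p] with q h1 h2 h3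
  rw [diffQuot, abs_div, abs_of_pos h3, div_le_iff₀ h3]
  refine (h _ _ h2 h1).trans_eq ?_
  rw [add_sub_cancel_left, map_smul_eq_mul, Real.norm_eq_abs, abs_of_pos h3]
  ring

theorem LipschitzNearZero.isBoundedUnder_le (hF : LipschitzNearZero p L F) (v : V) :
    (quotFilter p).IsBoundedUnder (· ≤ ·) (diffQuot F v) :=
  isBoundedUnder_of_eventually_le
    ((hF.eventually_abs_diffQuot_le v).mono fun _ h => (abs_le.1 h).2)

theorem LipschitzNearZero.isCoboundedUnder_le (hF : LipschitzNearZero p L F) (v : V) :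
    (quotFilter p).IsCoboundedUnder (· ≤ ·) (diffQuot F v) :=
  (isBoundedUnder_of_eventually_ge (f := quotFilter p) (a := -(L * p v))
    ((hF.eventually_abs_diffQuot_le v).mono fun _ h => (abs_le.1 h).1)).isCoboundedUnder_le

theorem LipschitzNearZero.seminormDeriv_le (hF : LipschitzNearZero p L F) (v : V) :
    seminormDeriv p F v ≤ L * p v :=
  limsup_le_of_le (hF.isCoboundedUnder_le v)
    ((hF.eventually_abs_diffQuot_le v).mono fun _ h => (abs_le.1 h).2)

/-- A limit of difference quotients along a finer filter is at most the upper derivative. -/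
theorem LipschitzNearZero.le_seminormDeriv (hF : LipschitzNearZero p L F) {ι : Type*}
    {m : Filter ι} [m.NeBot] {s : ι → V × ℝ} (hs : Tendsto s m (quotFilter p)) {v : V} {c : ℝ}
    (hc : Tendsto (fun i => diffQuot F v (s i)) m (𝓝 c)) : c ≤ seminormDeriv p F v := by
  refine le_of_forall_gt fun b hb => ?_
  obtain ⟨b', hb', hbb⟩ := exists_between hb
  have h := eventually_lt_of_limsup_lt hb' (hF.isBoundedUnder_le v)
  exact (le_of_tendsto hc ((hs.eventually h).mono fun _ h => h.le)).trans_lt hbb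

/-- The upper derivative is a limit of difference quotients along an ultrafilter. -/
theorem LipschitzNearZero.exists_ultrafilter (hF : LipschitzNearZero p L F) (v : V) :
    ∃ U : Ultrafilter (V × ℝ), ↑U ≤ quotFilter p ∧
      Tendsto (diffQuot F v) U (𝓝 (seminormDeriv p F v)) := by
  refine mapClusterPt_iff_ultrafilter.1 ?_
  -- The upper limit is a cluster point: quotients are frequently above any smaller number and
  -- eventually below any larger one.
  refine (nhds_basis_Ioo _).mapClusterPt_iff_frequently.2 fun I hI => ?_
  have h1 := frequently_lt_of_lt_limsup (hF.isCoboundedUnder_le v) hI.1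
  have h2 := eventually_lt_of_limsup_lt hI.2 (hF.isBoundedUnder_le v)
  exact (h1.and_eventually h2).mono fun _ h => h

/-- Difference quotients converge along every ultrafilter. -/
theorem LipschitzNearZero.exists_tendsto (hF : LipschitzNearZero p L F) (v : V)
    {U : Ultrafilter (V × ℝ)} (hU : ↑U ≤ quotFilter p) :
    ∃ w, Tendsto (diffQuot F v) U (𝓝 w) := by
  have h : ∀ᶠ q in (U : Filter (V × ℝ)), diffQuot F v q ∈ Set.Icc (-(L * p v)) (L * p v) :=
    hU ((hF.eventually_abs_diffQuot_le v).mono fun _ h => abs_le.1 h)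
  obtain ⟨w, -, hw⟩ := isCompact_Icc.ultrafilter_le_nhds (U.map (diffQuot F v))
    (le_principal_iff.2 h)
  exact ⟨w, hw⟩

/-- The quotient in direction `v + w` at `y` is the quotient in direction `v` at `y` plus the one in
direction `w` at `y + t • v`. Both summands converge along an ultrafilter realizing the left side.
-/
theorem LipschitzNearZero.seminormDeriv_add_le (hF : LipschitzNearZero p L F) (v w : V) :
    seminormDeriv p F (v + w) ≤ seminormDeriv p F v + seminormDeriv p F w := by
  obtain ⟨U, hU, h⟩ := hF.exists_ultrafilter (v + w)
  obtain ⟨a, ha⟩ := hF.exists_tendsto v hU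
  have hb : Tendsto (fun q : V × ℝ => diffQuot F w (q.1 + q.2 • v, q.2)) U
      (𝓝 (seminormDeriv p F (v + w) - a)) := by
    refine (h.sub ha).congr fun q => ?_
    simp only [diffQuot, smul_add, add_assoc]
    ring
  have h1 := hF.le_seminormDeriv (s := id) hU ha
  have h2 := hF.le_seminormDeriv ((tendsto_shear p v).mono_left hU) hb
  linarith

theorem LipschitzNearZero.mul_seminormDeriv_le (hF : LipschitzNearZero p L F) {c : ℝ} (hc : 0 < c)
    (v : V) : c * seminormDeriv p F v ≤ seminormDeriv p F (c • v) := by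
  obtain ⟨U, hU, h⟩ := hF.exists_ultrafilter v
  refine hF.le_seminormDeriv ((tendsto_rescale p (inv_pos.2 hc)).mono_left hU)
    ((h.const_mul c).congr fun q => ?_)
  have : (c⁻¹ * q.2) • c • v = q.2 • v := by
    rw [smul_smul]; congr 1; field_simp
  simp only [diffQuot, this]
  field_simp

theorem LipschitzNearZero.seminormDeriv_smul (hF : LipschitzNearZero p L F) {c : ℝ} (hc : 0 < c)
    (v : V) : seminormDeriv p F (c • v) = c * seminormDeriv p F v := by
  refine le_antisymm ?_ (hF.mul_seminormDeriv_le hc v)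
  have := hF.mul_seminormDeriv_le (inv_pos.2 hc) (c • v)
  rwa [inv_smul_smul₀ hc.ne', inv_mul_le_iff₀ hc] at this

/-- A limit of difference quotients in the direction `v` lies between `-F°(-v)` and `F°(v)`. -/
theorem LipschitzNearZero.neg_seminormDeriv_neg_le (hF : LipschitzNearZero p L F)
    {U : Ultrafilter (V × ℝ)} (hU : ↑U ≤ quotFilter p) {v : V} {w : ℝ}
    (hw : Tendsto (diffQuot F v) U (𝓝 w)) : -seminormDeriv p F (-v) ≤ w := by
  -- The quotient in direction `-v` based at `y + t • v` is minus the quotient in direction `v`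
  -- based at `y`.
  have := hF.le_seminormDeriv (v := -v) (c := -w) ((tendsto_shear p v).mono_left hU)
    (hw.neg.congr fun q => by
      simp only [diffQuot, smul_neg, add_neg_cancel_right, ← neg_div, neg_sub])
  linarith

end Seminorm

/-- A sublinear functional `N` dominates a linear functional with any prescribed value at `v`
between `-N (-v)` and `N v`. -/
theorem exists_linear_le_sublinear {V : Type*} [AddCommGroup V] [Module ℝ V] {N : V → ℝ}
    (hom : ∀ c : ℝ, 0 < c → ∀ x, N (c • x) = c * N x) (add : ∀ x y, N (x + y) ≤ N x + N y)
    {v : V} {w : ℝ} (h₁ : -N (-v) ≤ w) (h₂ : w ≤ N v) :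
    ∃ ζ : Module.Dual ℝ V, (∀ x, ζ x ≤ N x) ∧ ζ v = w := by
  have N0 : N 0 = 0 := by
    have := hom 2 two_pos 0
    rw [smul_zero] at this
    linarith
  have key : ∀ c : ℝ, c * w ≤ N (c • v) := by
    intro c
    rcases lt_trichotomy c 0 with hc | rfl | hc
    · have := hom (-c) (neg_pos.2 hc) (-v)
      rw [neg_smul_neg] at this
      nlinarith
    · simp [N0]
    · rw [hom c hc]
      exact mul_le_mul_of_nonneg_left h₂ hc.le
  -- Well-definedness of `c • v ↦ c * w`, which matters when `v = 0`: there the two bounds force `w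
  -- = 0`.
  have H : ∀ c : ℝ, c • v = 0 → (RingHom.id ℝ) c • w = 0 := by
    intro c hc
    have h3 := key c
    have h4 := key (-c)
    rw [neg_smul, hc, neg_zero, N0] at h4
    rw [hc, N0] at h3
    rw [RingHom.id_apply, smul_eq_mul]
    linarith
  obtain ⟨ζ, hζ, hle⟩ := exists_extension_of_le_sublinear
    (LinearPMap.mkSpanSingleton' v w H) N hom add (by
      rintro ⟨x, hx⟩
      obtain ⟨c, rfl⟩ := Submodule.mem_span_singleton.1 hx
      rw [LinearPMap.mkSpanSingleton'_apply]
      exact key c)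
  refine ⟨ζ, hle, ?_⟩
  have hv : v ∈ (LinearPMap.mkSpanSingleton' (σ := RingHom.id ℝ) v w H).domain :=
    Submodule.mem_span_singleton_self v
  rw [hζ ⟨v, hv⟩]
  exact LinearPMap.mkSpanSingleton'_apply_self v w H _

/-! ### Subgradients with a prescribed value in one direction -/

section Seminorm

variable {V : Type*} [AddCommGroup V] [Module ℝ V] {p : Seminorm ℝ V} {F : V → ℝ} {L : ℝ}

theorem LipschitzNearZero.exists_dual_eq (hF : LipschitzNearZero p L F) {v : V} {w : ℝ}
    (h₁ : -seminormDeriv p F (-v) ≤ w) (h₂ : w ≤ seminormDeriv p F v) :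
    ∃ ζ : Module.Dual ℝ V, (∀ x, ζ x ≤ seminormDeriv p F x) ∧ ζ v = w :=
  exists_linear_le_sublinear (fun _ hc => hF.seminormDeriv_smul hc) hF.seminormDeriv_add_le h₁ h₂

theorem LipschitzNearZero.exists_dual_eq_self (hF : LipschitzNearZero p L F) (v : V) :
    ∃ ζ : Module.Dual ℝ V, (∀ x, ζ x ≤ seminormDeriv p F x) ∧ ζ v = seminormDeriv p F v := by
  obtain ⟨U, hU, h⟩ := hF.exists_ultrafilter v
  exact hF.exists_dual_eq (hF.neg_seminormDeriv_neg_le hU h) le_rfl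

end Seminorm

/-! ### The Minkowski functional as a seminorm on `X₀` -/

section Gauge

variable {E : Type*} [AddCommGroup E] {C : Set E} {x₀ : E}

theorem zero_mem_shift (hx₀ : x₀ ∈ C) : (0 : E) ∈ shift C x₀ := by simpa [shift] using hx₀

theorem neg_mem_shift (hsymm : SymmetricAbout C x₀) {v : E} (hv : v ∈ shift C x₀) :
    -v ∈ shift C x₀ := by
  simpa [shift, sub_eq_add_neg] using hsymm v hv

variable [Module ℝ E]

theorem convex_shift (hconv : Convex ℝ C) : Convex ℝ (shift C x₀) :=
  hconv.translate_preimage_right x₀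

/-- This is what makes `C - x₀` absorbent in its span, so that `μ` is a genuine seminorm there. -/
theorem exists_smul_mem_shift (hx₀ : x₀ ∈ C) (hconv : Convex ℝ C) (hsymm : SymmetricAbout C x₀)
    {v : E} (hv : v ∈ dirSpace C x₀) : ∃ r : ℝ, 0 < r ∧ r • v ∈ shift C x₀ := by
  induction hv using Submodule.span_induction with
  | mem v hv => exact ⟨1, one_pos, by simpa using hv⟩
  | zero => exact ⟨1, one_pos, by simpa using zero_mem_shift hx₀⟩
  | add a b _ _ ha hb =>
    obtain ⟨r, hr, ha⟩ := ha
    obtain ⟨s, hs, hb⟩ := hb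
    -- `r • a` and `s • b` are combined with weights `s / (r + s)` and `r / (r + s)`, which
    -- equalizes the coefficients of `a` and `b`.
    refine ⟨r * s / (r + s), by positivity, ?_⟩
    have := convex_shift hconv ha hb (a := s / (r + s)) (b := r / (r + s)) (by positivity)
      (by positivity) (by field_simp; ring)
    rw [smul_smul, smul_smul] at this
    rw [smul_add]
    convert this using 3 <;> ring
  | smul c a _ ha =>
    obtain ⟨r, hr, ha⟩ := ha
    rcases lt_trichotomy c 0 with hc | rfl | hc
    · refine ⟨r / -c, div_pos hr (neg_pos.2 hc), ?_⟩
      have h : r / -c * c = -r := by rw [div_neg, neg_mul, div_mul_cancel₀ _ hc.ne]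
      rw [smul_smul, h, neg_smul]
      exact neg_mem_shift hsymm ha
    · exact ⟨1, one_pos, by simpa using zero_mem_shift hx₀⟩
    · refine ⟨r / c, div_pos hr hc, ?_⟩
      rwa [smul_smul, div_mul_cancel₀ _ hc.ne']

/-- `C - x₀` as a subset of `X₀`. -/
def shiftIn (C : Set E) (x₀ : E) : Set (dirSpace C x₀) := {v | (v : E) ∈ shift C x₀}

theorem convex_shiftIn (hconv : Convex ℝ C) : Convex ℝ (shiftIn C x₀) :=
  (convex_shift hconv).linear_preimage (dirSpace C x₀).subtype

theorem smul_mem_shiftIn (hx₀ : x₀ ∈ C) (hconv : Convex ℝ C) (hsymm : SymmetricAbout C x₀)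
    {c : ℝ} (hc : |c| ≤ 1) {v : dirSpace C x₀} (hv : v ∈ shiftIn C x₀) : c • v ∈ shiftIn C x₀ := by
  have key : ∀ {a : ℝ}, 0 ≤ a → a ≤ 1 → ∀ {v : dirSpace C x₀}, v ∈ shiftIn C x₀ →
      a • v ∈ shiftIn C x₀ := fun h0 h1 _ hv =>
    (convex_shiftIn hconv).smul_mem_of_zero_mem (zero_mem_shift hx₀) hv ⟨h0, h1⟩
  rcases le_total 0 c with h | h
  · exact key h ((le_abs_self c).trans hc) hv
  · have := key (neg_nonneg.2 h) ((neg_le_abs c).trans hc) (v := -v) (neg_mem_shift hsymm hv)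
    rwa [neg_smul_neg] at this

theorem balanced_shiftIn (hx₀ : x₀ ∈ C) (hconv : Convex ℝ C) (hsymm : SymmetricAbout C x₀) :
    Balanced ℝ (shiftIn C x₀) := by
  rintro c hc _ ⟨v, hv, rfl⟩
  exact smul_mem_shiftIn hx₀ hconv hsymm hc hv

theorem absorbent_shiftIn (hx₀ : x₀ ∈ C) (hconv : Convex ℝ C) (hsymm : SymmetricAbout C x₀) :
    Absorbent ℝ (shiftIn C x₀) := by
  rw [absorbent_iff_inv_smul]
  intro v
  obtain ⟨r, hr, hv⟩ := exists_smul_mem_shift hx₀ hconv hsymm v.2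
  filter_upwards [eventually_cobounded_le_norm (r⁻¹ : ℝ)] with c hc
  have hc0 : 0 < |c| := (inv_pos.2 hr).trans_le hc
  -- `c⁻¹ • v = (c⁻¹ * r⁻¹) • (r • v)`, where the factor has absolute value at most one.
  have := smul_mem_shiftIn hx₀ hconv hsymm (c := c⁻¹ * r⁻¹) (v := r • v) (by
    rw [abs_mul, abs_inv, abs_of_pos (inv_pos.2 hr), inv_mul_le_iff₀ hc0, mul_one]
    exact hc) hv
  rwa [smul_smul, inv_mul_cancel_right₀ hr.ne'] at this

theorem gauge_shiftIn (v : dirSpace C x₀) : gauge (shiftIn C x₀) v = mu C x₀ (v : E) := by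
  rw [mu, gauge_def', gauge_def']
  rfl

/-- The Minkowski functional `μ` as a seminorm on `X₀`. -/
noncomputable def muSeminorm (hx₀ : x₀ ∈ C) (hconv : Convex ℝ C) (hsymm : SymmetricAbout C x₀) :
    Seminorm ℝ (dirSpace C x₀) :=
  gaugeSeminorm (balanced_shiftIn hx₀ hconv hsymm) (convex_shiftIn hconv)
    (absorbent_shiftIn hx₀ hconv hsymm)

variable (hx₀ : x₀ ∈ C) (hconv : Convex ℝ C) (hsymm : SymmetricAbout C x₀)

theorem coe_muSeminorm :
    ⇑(muSeminorm hx₀ hconv hsymm) = fun v : dirSpace C x₀ => mu C x₀ (v : E) :=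
  funext gauge_shiftIn

theorem mem_of_muSeminorm_lt_one {v : dirSpace C x₀} (hv : muSeminorm hx₀ hconv hsymm v < 1) :
    x₀ + (v : E) ∈ C :=
  setOfPred_gauge_lt_one_subset_self (convex_shiftIn hconv) (zero_mem_shift hx₀)
    (absorbent_shiftIn hx₀ hconv hsymm) hv

/-- A `μ`-Lipschitz function is Lipschitz near each point of `B_μ(x₀, 1)`. -/
theorem MuLipschitz.exists_lipschitzNearZero {f : E → ℝ} (hf : MuLipschitz C x₀ f) {x : E}
    (hx : x ∈ muBall C x₀) :
    ∃ L, LipschitzNearZero (muSeminorm hx₀ hconv hsymm) L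
      (fun u : dirSpace C x₀ => f (x + (dirSpace C x₀).subtype u)) := by
  obtain ⟨L, -, hL⟩ := hf
  obtain ⟨hxm, hx1⟩ := hx
  set p := muSeminorm hx₀ hconv hsymm
  have hp : ∀ v : dirSpace C x₀, p v = mu C x₀ (v : E) :=
    fun v => congrFun (coe_muSeminorm hx₀ hconv hsymm) v
  -- By the triangle inequality the `μ`-ball about `x` of radius `1 - μ (x - x₀)` stays inside
  -- `B_μ(x₀, 1)`, hence inside `C`.
  have hmem : ∀ u : dirSpace C x₀, p u < 1 - mu C x₀ (x - x₀) → x + (u : E) ∈ C := by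
    intro u hu
    have := mem_of_muSeminorm_lt_one hx₀ hconv hsymm (v := ⟨x - x₀, hxm⟩ + u)
      ((map_add_le_add p _ _).trans_lt (by rw [hp ⟨x - x₀, hxm⟩]; linarith))
    simpa [← add_assoc] using this
  refine ⟨L, 1 - mu C x₀ (x - x₀), by linarith, fun u v hu hv => ?_⟩
  have := hL _ (hmem u hu) _ (hmem v hv)
  rwa [add_sub_add_left_eq_sub, ← Submodule.coe_sub, ← hp] at this

end Gauge

/-! ### The chain rule for upper derivatives with respect to a seminorm -/

section Chain

variable {V : Type*} [AddCommGroup V] [Module ℝ V] {p : Seminorm ℝ V} {n : ℕ}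
  {H : V → EuclideanSpace ℝ (Fin n)} {L : Fin n → ℝ} {g : EuclideanSpace ℝ (Fin n) → ℝ}
  {K : NNReal}

theorem LipschitzNearZero.tendsto_zero {F : V → ℝ} {M : ℝ} (hF : LipschitzNearZero p M F) :
    Tendsto F (comap p (𝓝 0)) (𝓝 (F 0)) := by
  obtain ⟨r, hr, h⟩ := hF
  rw [tendsto_iff_dist_tendsto_zero]
  refine squeeze_zero' (Eventually.of_forall fun _ => dist_nonneg) ?_
    (g := fun u => M * p u) (by simpa using (tendsto_comap (f := p) (x := 𝓝 0)).const_mul M)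
  filter_upwards [tendsto_comap.eventually (gt_mem_nhds hr)] with u hu
  simpa [Real.dist_eq] using h u 0 hu (by simpa using hr)

theorem tendsto_euclidean {ι : Type*} {m : Filter ι} {f : ι → EuclideanSpace ℝ (Fin n)}
    {w : EuclideanSpace ℝ (Fin n)} (h : ∀ i, Tendsto (fun j => f j i) m (𝓝 (w i))) :
    Tendsto f m (𝓝 w) :=
  ((PiLp.continuous_toLp 2 fun _ : Fin n => ℝ).tendsto w.ofLp).comp (tendsto_pi_nhds.2 h)

theorem tendsto_euclidean_zero (hH : ∀ i, LipschitzNearZero p (L i) fun u => H u i) :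
    Tendsto H (comap p (𝓝 0)) (𝓝 (H 0)) :=
  tendsto_euclidean fun i => (hH i).tendsto_zero

/-- Moves the base point to the origin, so that `muDeriv` and `clarkeDeriv` both become instances of
`seminormDeriv`. -/
theorem upperDeriv_map {E : Type*} [AddCommGroup E] [Module ℝ E] (φ : V →ₗ[ℝ] E) (x : E)
    (l : Filter V) (f : E → ℝ) (v : V) :
    upperDeriv (map (fun u => x + φ u) l) f (φ v) = upperDeriv l (fun u => f (x + φ u)) v := by
  rw [upperDeriv, upperDeriv, prod_map_left, limsup, map_map, limsup]
  congr 2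
  funext q
  simp [add_assoc]

theorem clarkeDeriv_eq (g : EuclideanSpace ℝ (Fin n) → ℝ) (u w : EuclideanSpace ℝ (Fin n)) :
    clarkeDeriv g u w = seminormDeriv (normSeminorm ℝ _) (fun z => g (u + z)) w := by
  have h : 𝓝 u = map (fun z => u + LinearMap.id (R := ℝ) z)
      (comap (normSeminorm ℝ (EuclideanSpace ℝ (Fin n))) (𝓝 0)) := by
    rw [coe_normSeminorm, comap_norm_nhds_zero]
    simp
  rw [clarkeDeriv, h]
  exact upperDeriv_map LinearMap.id u _ g w

theorem lipschitzNearZero_norm (hg : LipschitzWith K g) (u : EuclideanSpace ℝ (Fin n)) :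
    LipschitzNearZero (normSeminorm ℝ (EuclideanSpace ℝ (Fin n))) K (fun z => g (u + z)) :=
  ⟨1, one_pos, fun a b _ _ => by
    simpa [Real.dist_eq, dist_eq_norm] using hg.dist_le_mul (u + a) (u + b)⟩

/-- In a difference quotient of `g ∘ H`, the increment of `H` may be replaced by its
first-order approximation. -/
theorem tendsto_diffQuot_comp_sub (hg : LipschitzWith K g) {m : Filter (V × ℝ)}
    (hm : m ≤ quotFilter p) {v : V} {w : EuclideanSpace ℝ (Fin n)}
    (hw : ∀ i, Tendsto (diffQuot (fun u => H u i) v) m (𝓝 (w i))) :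
    Tendsto (fun q => diffQuot (g ∘ H) v q - diffQuot g w (H q.1, q.2)) m (𝓝 0) := by
  have h1 : Tendsto (fun q : V × ℝ => q.2⁻¹ • (H (q.1 + q.2 • v) - H q.1)) m (𝓝 w) := by
    refine tendsto_euclidean fun i => (hw i).congr fun q => ?_
    simp [diffQuot, div_eq_inv_mul]
  have h2 := ((tendsto_iff_norm_sub_tendsto_zero.1 h1).const_mul (K : ℝ))
  rw [mul_zero] at h2
  refine squeeze_zero_norm' ?_ h2
  filter_upwards [hm (eventually_snd_pos p)] with q hq
  simp only [diffQuot, Function.comp_apply]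
  rw [← sub_div, sub_sub_sub_cancel_right, norm_div, Real.norm_of_nonneg hq.le, div_le_iff₀ hq,
    ← dist_eq_norm]
  refine (hg.dist_le_mul _ _).trans_eq ?_
  have h3 : H (q.1 + q.2 • v) - (H q.1 + q.2 • w)
      = q.2 • (q.2⁻¹ • (H (q.1 + q.2 • v) - H q.1) - w) := by
    rw [smul_sub, smul_inv_smul₀ hq.ne']
    abel
  rw [dist_eq_norm, h3, norm_smul, Real.norm_of_nonneg hq.le]
  ring

theorem le_clarkeDeriv (hg : LipschitzWith K g) {u w : EuclideanSpace ℝ (Fin n)} {ι : Type*}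
    {m : Filter ι} [m.NeBot] {y : ι → EuclideanSpace ℝ (Fin n)} {t : ι → ℝ}
    (hy : Tendsto y m (𝓝 u)) (ht : Tendsto t m (𝓝[>] 0)) {c : ℝ}
    (hc : Tendsto (fun i => diffQuot g w (y i, t i)) m (𝓝 c)) : c ≤ clarkeDeriv g u w := by
  rw [clarkeDeriv_eq]
  refine (lipschitzNearZero_norm hg u).le_seminormDeriv
    (s := fun i => (y i - u, t i)) (Tendsto.prodMk ?_ ht) (hc.congr fun i => ?_)
  · rw [coe_normSeminorm, comap_norm_nhds_zero]
    exact tendsto_sub_nhds_zero_iff.2 hy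
  · simp only [diffQuot, add_sub_cancel, ← add_assoc]

/-- Every value of the upper derivative of `g ∘ H` is dominated by a functional of the form
occurring on the right-hand side of the chain rule. -/
theorem exists_chain_ge (hH : ∀ i, LipschitzNearZero p (L i) fun u => H u i)
    (hg : LipschitzWith K g) {M : ℝ} (hgH : LipschitzNearZero p M (g ∘ H)) (v : V) :
    ∃ ζ : Fin n → Module.Dual ℝ V, ∃ α ∈ clarkeSubdiff g (H 0),
      (∀ i u, ζ i u ≤ seminormDeriv p (fun z => H z i) u) ∧
        seminormDeriv p (g ∘ H) v ≤ (∑ i, α i • ζ i) v := by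
  obtain ⟨U, hU, hlim⟩ := hgH.exists_ultrafilter v
  choose w hw using fun i => (hH i).exists_tendsto v hU
  choose ζ hζ hζv using fun i => (hH i).exists_dual_eq ((hH i).neg_seminormDeriv_neg_le hU (hw i))
    ((hH i).le_seminormDeriv (s := id) hU (hw i))
  -- `β` attains `g°(H 0; w)` at `w`; its values on the standard basis are the coefficients `α`.
  obtain ⟨β, hβ, hβw⟩ := (lipschitzNearZero_norm hg (H 0)).exists_dual_eq_self (WithLp.toLp 2 w)
  have hβ_sum : ∀ z, ∑ i, β (EuclideanSpace.single i 1) * z i = β z := by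
    intro z
    conv_rhs => rw [← (EuclideanSpace.basisFun (Fin n) ℝ).sum_repr z]
    simp [mul_comm]
  refine ⟨ζ, WithLp.toLp 2 fun i => β (EuclideanSpace.single i 1), fun z => ?_, hζ, ?_⟩
  · rw [clarkeDeriv_eq]
    exact (hβ_sum z).trans_le (hβ z)
  -- The quotients of `g` in the fixed direction `w`, at the moving base points `H q.1`, have the
  -- same limit as those of `g ∘ H`.
  · have h1 := hlim.sub (tendsto_diffQuot_comp_sub (w := WithLp.toLp 2 w) hg hU hw)
    simp only [sub_sub_cancel, sub_zero] at h1
    have h2 := le_clarkeDeriv hg ((tendsto_euclidean_zero hH).comp (tendsto_fst.mono_left hU))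
      ((tendsto_snd_quotFilter p).mono_left hU) h1
    rw [clarkeDeriv_eq, ← hβw, ← hβ_sum] at h2
    simpa [hζv] using h2

/-- Under regularity, and for non-negative coefficients, the functionals on the right-hand side
of the chain rule are dominated by the upper derivative of `g ∘ H`. -/
theorem chain_le (hg : LipschitzWith K g) {M : ℝ} (hgH : LipschitzNearZero p M (g ∘ H))
    (hgreg : ClarkeRegularAt g (H 0)) {v : V}
    (hHreg : ∀ i, HasDirDeriv (fun u => H u i) 0 v (seminormDeriv p (fun u => H u i) v))
    {ζ : Fin n → Module.Dual ℝ V} {α : EuclideanSpace ℝ (Fin n)}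
    (hα : α ∈ clarkeSubdiff g (H 0)) (hα₀ : ∀ i, 0 ≤ α i)
    (hζ : ∀ i u, ζ i u ≤ seminormDeriv p (fun z => H z i) u) :
    (∑ i, α i • ζ i) v ≤ seminormDeriv p (g ∘ H) v := by
  set w : EuclideanSpace ℝ (Fin n) := WithLp.toLp 2 fun i => seminormDeriv p (fun u => H u i) v
  have h1 : (∑ i, α i • ζ i) v ≤ clarkeDeriv g (H 0) w := by
    refine le_trans ?_ (hα w)
    rw [LinearMap.sum_apply]
    exact Finset.sum_le_sum fun i _ => mul_le_mul_of_nonneg_left (hζ i v) (hα₀ i)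
  refine h1.trans ?_
  obtain ⟨d, hd, rfl⟩ := hgreg w
  -- Freezing the base point at the origin turns these quotients into those of one-sided directional
  -- derivatives.
  have hfst : Tendsto (fun t : ℝ => ((0 : V), t)) (𝓝[>] 0) (pure (0 : V) ×ˢ 𝓝[>] (0 : ℝ)) :=
    (tendsto_const_pure).prodMk tendsto_id
  have h2 := (tendsto_diffQuot_comp_sub (w := w) (v := v) (H := H)
    (m := map (fun t : ℝ => ((0 : V), t)) (𝓝[>] 0)) hg (hfst.trans (pure_zero_prod_le p))
      fun i => tendsto_map'_iff.2 (hHreg i))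
  have h3 := (tendsto_map'_iff.1 h2).add hd
  refine hgH.le_seminormDeriv (hfst.trans (pure_zero_prod_le p)) (m := 𝓝[>] (0 : ℝ)) ?_ (v := v)
  rw [zero_add] at h3
  exact h3.congr fun t => by simp [diffQuot]

end Chain

/-! ### Weak-star closed convex hulls -/

section Dual

variable {V : Type*} [AddCommGroup V] [Module ℝ V] [TopologicalSpace V]

/-- Evaluation at `v` is linear and weak-star continuous, so each bound cuts out a closed
half-space. -/
theorem weakStarHull_subset {A : Set (Module.Dual ℝ V)} {N : V → ℝ}
    (hA : ∀ ξ ∈ A, ∀ v, ξ v ≤ N v) :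
    weakStarHull A ⊆ {ζ | ∀ v, ζ v ≤ N v} := by
  rintro _ ⟨ξ, hξ, rfl⟩ v
  have hcl : IsClosed {η : WeakDual ℝ V | η v ≤ N v} :=
    isClosed_le (WeakDual.eval_continuous v) continuous_const
  have hcv : Convex ℝ {η : WeakDual ℝ V | η v ≤ N v} := by
    exact convex_halfSpace_le (f := fun η : WeakDual ℝ V => η v) ⟨fun _ _ => rfl, fun _ _ => rfl⟩ _
  have hsub : dualIncl V ⁻¹' A ⊆ {η : WeakDual ℝ V | η v ≤ N v} := fun η hη => hA _ hη v
  exact closure_minimal (convexHull_min hsub hcv) hcl hξ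

/-- If the supremum of `A` dominates a continuous functional on each vector, the functional
belongs to the weak-star closed convex hull of `A`. -/
theorem mem_weakStarHull {A : Set (Module.Dual ℝ V)} (hA : A ⊆ Set.range (dualIncl V))
    {ζ : WeakDual ℝ V} (h : ∀ v, ∃ ξ ∈ A, ζ v ≤ ξ v) : dualIncl V ζ ∈ weakStarHull A := by
  refine ⟨ζ, ?_, rfl⟩
  by_contra hζ
  have : LocallyConvexSpace ℝ (WeakDual ℝ V) :=
    inferInstanceAs (LocallyConvexSpace ℝ (WeakBilin (topDualPairing ℝ V)))
  obtain ⟨f, c, hf, hc⟩ := geometric_hahn_banach_closed_point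
    (convex_convexHull ℝ (dualIncl V ⁻¹' A)).closure isClosed_closure hζ
  -- A `σ(V*, V)`-continuous functional is evaluation at a vector, so the separation takes place at
  -- some `v`.
  obtain ⟨v, rfl⟩ := LinearMap.dualEmbedding_surjective (topDualPairing ℝ V) f
  obtain ⟨_, hξ, hle⟩ := h v
  obtain ⟨ξ, rfl⟩ := hA hξ
  have h1 : ξ v < c := hf ξ (subset_closure (subset_convexHull ℝ _ hξ))
  exact absurd (hc.trans_le hle) h1.not_gt

end Dual


/-! ### The chain rule for `μ`-Lipschitz functions -/

section Main

variable {E : Type*} [AddCommGroup E] [Module ℝ E] {C : Set E} {x₀ : E} {n : ℕ}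
  {h : E → EuclideanSpace ℝ (Fin n)} {g : EuclideanSpace ℝ (Fin n) → ℝ} {K : NNReal}

theorem norm_le_sum_abs (z : EuclideanSpace ℝ (Fin n)) : ‖z‖ ≤ ∑ i, |z i| := by
  conv_lhs => rw [← (EuclideanSpace.basisFun (Fin n) ℝ).sum_repr z]
  refine (norm_sum_le _ _).trans_eq ?_
  simp [norm_smul]

theorem MuLipschitz.comp (hg : LipschitzWith K g) (hh : ∀ i, MuLipschitz C x₀ fun y => h y i) :
    MuLipschitz C x₀ (g ∘ h) := by
  choose L hL hLip using hh
  -- The added `1` keeps the constant positive when `K` or the sum vanishes.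
  refine ⟨K * ∑ i, L i + 1,
    add_pos_of_nonneg_of_pos (mul_nonneg K.2 (Finset.sum_nonneg fun i _ => (hL i).le)) one_pos,
    fun u hu v hv => ?_⟩
  calc |g (h u) - g (h v)| ≤ K * ‖h u - h v‖ := by
        simpa [Real.dist_eq, dist_eq_norm] using hg.dist_le_mul (h u) (h v)
    _ ≤ K * ∑ i, L i * mu C x₀ (u - v) := by
        refine mul_le_mul_of_nonneg_left ((norm_le_sum_abs _).trans ?_) K.2
        exact Finset.sum_le_sum fun i _ => hLip i u hu v hv
    _ ≤ (K * ∑ i, L i + 1) * mu C x₀ (u - v) := by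
        rw [← Finset.sum_mul, add_mul, ← mul_assoc]
        linarith [gauge_nonneg (s := shift C x₀) (u - v), show mu C x₀ (u - v) = gauge _ _ from rfl]

variable (hx₀ : x₀ ∈ C) (hconv : Convex ℝ C) (hsymm : SymmetricAbout C x₀)

theorem muDeriv_eq (f : E → ℝ) (x : E) (v : dirSpace C x₀) :
    muDeriv C x₀ f x v = seminormDeriv (muSeminorm hx₀ hconv hsymm)
      (fun u => f (x + (dirSpace C x₀).subtype u)) v := by
  rw [muDeriv, muNhds, ← coe_muSeminorm hx₀ hconv hsymm]
  exact upperDeriv_map (dirSpace C x₀).subtype x _ f v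

theorem MuLipschitz.exists_dual_le (hx₀ : x₀ ∈ C) (hconv : Convex ℝ C)
    (hsymm : SymmetricAbout C x₀) {f : E → ℝ} (hf : MuLipschitz C x₀ f) {x : E}
    (hx : x ∈ muBall C x₀) : ∃ L, ∀ ζ ∈ muSubdiff C x₀ f x, ∀ v : dirSpace C x₀,
      ζ v ≤ L * mu C x₀ (v : E) := by
  obtain ⟨L, hL⟩ := hf.exists_lipschitzNearZero hx₀ hconv hsymm hx
  refine ⟨L, fun ζ hζ v => (hζ v).trans ?_⟩
  rw [muDeriv_eq hx₀ hconv hsymm, ← congrFun (coe_muSeminorm hx₀ hconv hsymm) v]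
  exact hL.seminormDeriv_le v

/-- Applying the bound to `-v` makes it two-sided because `p` is even; for an additive map,
continuity at `0` suffices. -/
theorem continuous_of_le_mul {V : Type*} [AddCommGroup V] [Module ℝ V] [TopologicalSpace V]
    [IsTopologicalAddGroup V] {p : V → ℝ} (hp : Continuous p) (hp₀ : p 0 = 0)
    (hneg : ∀ v, p (-v) = p v) {L : ℝ} {ζ : Module.Dual ℝ V} (hζ : ∀ v, ζ v ≤ L * p v) :
    Continuous ζ := by
  refine continuous_of_continuousAt_zero ζ ?_
  rw [ContinuousAt, map_zero]
  refine squeeze_zero_norm (a := fun v => L * p v) (fun v => ?_) ?_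
  · rw [Real.norm_eq_abs, abs_le']
    refine ⟨hζ v, ?_⟩
    rw [← map_neg, ← hneg v]
    exact hζ (-v)
  · simpa [hp₀] using (hp.tendsto 0).const_mul L

/-- Subgradients of `μ`-Lipschitz functions are continuous whenever `μ` is. -/
theorem MuLipschitz.continuous_of_mem_muSubdiff (hx₀ : x₀ ∈ C) (hconv : Convex ℝ C)
    (hsymm : SymmetricAbout C x₀) [TopologicalSpace (dirSpace C x₀)]
    [IsTopologicalAddGroup (dirSpace C x₀)]
    (hμ : Continuous fun v : dirSpace C x₀ => mu C x₀ (v : E)) {f : E → ℝ}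
    (hf : MuLipschitz C x₀ f) {x : E} (hx : x ∈ muBall C x₀)
    {ζ : Module.Dual ℝ (dirSpace C x₀)} (hζ : ζ ∈ muSubdiff C x₀ f x) : Continuous ζ := by
  obtain ⟨L, hL⟩ := hf.exists_dual_le hx₀ hconv hsymm hx
  rw [← coe_muSeminorm hx₀ hconv hsymm] at hμ
  refine continuous_of_le_mul hμ (map_zero _) (map_neg_eq_map _) (L := L) fun v => ?_
  rw [coe_muSeminorm]
  exact hL ζ hζ v

theorem exists_mem_chainSet_ge (hx₀ : x₀ ∈ C) (hconv : Convex ℝ C) (hsymm : SymmetricAbout C x₀)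
    (hh : ∀ i, MuLipschitz C x₀ fun y => h y i) (hg : LipschitzWith K g) {x : E}
    (hx : x ∈ muBall C x₀) (v : dirSpace C x₀) :
    ∃ ξ ∈ chainSet C x₀ g h x, muDeriv C x₀ (g ∘ h) x v ≤ ξ v := by
  choose L hH using fun i => (hh i).exists_lipschitzNearZero hx₀ hconv hsymm hx
  obtain ⟨M, hgH⟩ := (MuLipschitz.comp hg hh).exists_lipschitzNearZero hx₀ hconv hsymm hx
  obtain ⟨ζ, α, hα, hζ, hle⟩ :=
    exists_chain_ge (H := fun u => h (x + (dirSpace C x₀).subtype u)) hH hg hgH v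
  rw [map_zero, add_zero] at hα
  refine ⟨_, ⟨ζ, α, hα, fun i u => ?_, rfl⟩, ?_⟩
  · rw [muDeriv_eq hx₀ hconv hsymm]
    exact hζ i u
  · rw [muDeriv_eq hx₀ hconv hsymm]
    exact hle

theorem chainSet_le_muDeriv (hx₀ : x₀ ∈ C) (hconv : Convex ℝ C) (hsymm : SymmetricAbout C x₀)
    (hh : ∀ i, MuLipschitz C x₀ fun y => h y i) (hg : LipschitzWith K g) {x : E}
    (hx : x ∈ muBall C x₀) (hgreg : ClarkeRegularAt g (h x))
    (hhreg : ∀ i, MuRegularAt C x₀ (fun y => h y i) x)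
    (hnonneg : ∀ α ∈ clarkeSubdiff g (h x), ∀ i, 0 ≤ α i) {ξ : Module.Dual ℝ (dirSpace C x₀)}
    (hξ : ξ ∈ chainSet C x₀ g h x) (v : dirSpace C x₀) :
    ξ v ≤ muDeriv C x₀ (g ∘ h) x v := by
  obtain ⟨M, hgH⟩ := (MuLipschitz.comp hg hh).exists_lipschitzNearZero hx₀ hconv hsymm hx
  obtain ⟨ζ, α, hα, hζ, rfl⟩ := hξ
  have h0 : h (x + (dirSpace C x₀).subtype 0) = h x := by rw [map_zero, add_zero]
  rw [muDeriv_eq hx₀ hconv hsymm]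
  refine chain_le (H := fun u => h (x + (dirSpace C x₀).subtype u)) hg hgH (by rwa [h0])
    (fun i => ?_) (by rwa [h0]) (hnonneg α hα) fun i u => ?_
  · obtain ⟨d, hd, hdeq⟩ := hhreg i v
    rw [muDeriv_eq hx₀ hconv hsymm] at hdeq
    rw [← hdeq]
    simpa [HasDirDeriv] using hd
  · rw [← muDeriv_eq hx₀ hconv hsymm (fun y => h y i)]
    exact hζ i u

theorem chainSet_subset_range (hx₀ : x₀ ∈ C) (hconv : Convex ℝ C) (hsymm : SymmetricAbout C x₀)
    [TopologicalSpace (dirSpace C x₀)] [IsTopologicalAddGroup (dirSpace C x₀)]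
    (hμ : Continuous fun v : dirSpace C x₀ => mu C x₀ (v : E))
    (hh : ∀ i, MuLipschitz C x₀ fun y => h y i) {x : E} (hx : x ∈ muBall C x₀) :
    chainSet C x₀ g h x ⊆ Set.range (dualIncl (dirSpace C x₀)) := by
  rintro _ ⟨ζ, α, -, hζ, rfl⟩
  have hcont : Continuous (∑ i, α i • ζ i : Module.Dual ℝ (dirSpace C x₀)) := by
    simp only [LinearMap.coe_sum, LinearMap.coe_smul, Finset.sum_fn]
    exact continuous_finsetSum _ fun i _ =>
      ((hh i).continuous_of_mem_muSubdiff hx₀ hconv hsymm hμ hx (hζ i)).const_smul (α i)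
  exact ⟨StrongDual.toWeakDual ⟨_, hcont⟩, rfl⟩

end Main

end MuClarke

theorem theorem3p2 {E : Type*} [AddCommGroup E] [Module ℝ E]
    (C : Set E) (x₀ : E) (hx₀ : x₀ ∈ C) (hconv : Convex ℝ C)
    (hsymm : MuClarke.SymmetricAbout C x₀)
    (n : ℕ) (h : E → EuclideanSpace ℝ (Fin n))
    (hh : ∀ i, MuClarke.MuLipschitz C x₀ (fun y => h y i))
    (g : EuclideanSpace ℝ (Fin n) → ℝ) (hg : ∃ K : NNReal, LipschitzWith K g)
    [TopologicalSpace (MuClarke.dirSpace C x₀)]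
    [IsTopologicalAddGroup (MuClarke.dirSpace C x₀)]
    [ContinuousSMul ℝ (MuClarke.dirSpace C x₀)]
    (hμ : Continuous fun v : MuClarke.dirSpace C x₀ => MuClarke.mu C x₀ (v : E))
    (x : E) (hx : x ∈ MuClarke.muBall C x₀) :
    -- the set under the closed convex hull consists of continuous functionals
    MuClarke.chainSet C x₀ g h x ⊆ Set.range (MuClarke.dualIncl (MuClarke.dirSpace C x₀)) ∧
    -- the inclusion
    MuClarke.muSubdiff C x₀ (g ∘ h) x ⊆
      MuClarke.weakStarHull (MuClarke.chainSet C x₀ g h x) ∧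
    -- the case of equality
    (MuClarke.ClarkeRegularAt g (h x) →
      (∀ i, MuClarke.MuRegularAt C x₀ (fun y => h y i) x) →
      (∀ α ∈ MuClarke.clarkeSubdiff g (h x), ∀ i, 0 ≤ α i) →
      T2Space (MuClarke.dirSpace C x₀) →
      LocallyConvexSpace ℝ (MuClarke.dirSpace C x₀) →
      @CompleteSpace (MuClarke.dirSpace C x₀)
        (IsTopologicalAddGroup.rightUniformSpace (MuClarke.dirSpace C x₀)) →
      MuClarke.muSubdiff C x₀ (g ∘ h) x =
        MuClarke.weakStarHull (MuClarke.chainSet C x₀ g h x)) := by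
  obtain ⟨K, hg⟩ := hg
  have hrange := MuClarke.chainSet_subset_range (g := g) hx₀ hconv hsymm hμ hh hx
  have hincl : MuClarke.muSubdiff C x₀ (g ∘ h) x ⊆
      MuClarke.weakStarHull (MuClarke.chainSet C x₀ g h x) := by
    intro ζ hζ
    have hcont := (MuClarke.MuLipschitz.comp hg hh).continuous_of_mem_muSubdiff
      hx₀ hconv hsymm hμ hx hζ
    -- `ζ v ≤ φ°(v)`, and `φ°(v)` is at most the value at `v` of some member of the chain set.
    refine MuClarke.mem_weakStarHull hrange (ζ := StrongDual.toWeakDual ⟨ζ, hcont⟩) fun v => ?_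
    obtain ⟨ξ, hξ, hle⟩ := MuClarke.exists_mem_chainSet_ge hx₀ hconv hsymm hh hg hx v
    exact ⟨ξ, hξ, (hζ v).trans hle⟩
  refine ⟨hrange, hincl, fun hgreg hhreg hnonneg _ _ _ => hincl.antisymm ?_⟩
  exact MuClarke.weakStarHull_subset fun ξ hξ =>
    MuClarke.chainSet_le_muDeriv hx₀ hconv hsymm hh hg hx hgreg hhreg hnonneg hξ
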